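/- Let $\mathcal X,\mathcal Y$ be finite sets and let $W=\{W(x,y|x',y')\}$ be an irreducible transition matrix on $\mathcal X\times\mathcal Y$ (so $W(x,y|x',y')\ge 0$ and $\sum_{x,y}W(x,y|x',y')=1$ for all $x',y'$). Suppose that $W$ is non-hidden with respect to $\mathcal Y$: the sum $W(y|y'):=\sum_{x}W(x,y|x',y')$ does not depend on $x'$, for all $y,y'\in\mathcal Y$. For $\theta>-1$ let $\lambda_\theta$ be the Perron–Frobenius eigenvalue (spectral radius) of the matrix $W(x,y|x',y')^{1+\theta}\,W(y|y')^{-\theta}$ (an entry being $0$ where $W(x,y|x',y')=0$), and for $\theta\neq 0$ put $$H^{\downarrow,W}_{1+\theta}(X|Y):=-\frac1\theta\log\lambda_\theta .$$ Then the limits $$H^W(X|Y):=\lim_{\theta\to0}H^{\downarrow,W}_{1+\theta}(X|Y),\qquad \mathsf V^W(X|Y):=\lim_{\theta\to0}\frac{2\left[H^W(X|Y)-H^{\downarrow,W}_{1+\theta}(X|Y)\right]}{\theta}$$ exist as real numbers, and for every initial distribution $P_{X_1Y_1}$ on $\mathcal X\times\mathcal Y$ the Markov chain $(X_i,Y_i)_{i\ge1}$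 with initial distribution $P_{X_1Y_1}$ and transition matrix $W$ satisfies $$\lim_{n\to\infty}\frac1n\,\mathsf V(X^n|Y^n)=\mathsf V^W(X|Y),$$ where $X^n=(X_1,\dots,X_n)$, $Y^n=(Y_1,\dots,Y_n)$ and $\mathsf V(X^n|Y^n):=\mathrm{Var}\left[\log\frac{1}{P_{X^n|Y^n}(X^n|Y^n)}\right]$. -/

import Mathlib

noncomputable section

namespace MarkovVariance

/-- The conditional probability `P_{U|V}(u|v) = μ(U = u | V = v)`. -/
def condProb {Ω A B : Type*} [MeasurableSpace Ω] (μ : MeasureTheory.Measure Ω)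
    (U : Ω → A) (V : Ω → B) (u : A) (v : B) : ℝ :=
  (ProbabilityTheory.cond μ (V ⁻¹' {v})).real (U ⁻¹' {u})

/-- `V(U|V) = Var[log (1 / P_{U|V}(U|V))]`. -/
def condVar {Ω A B : Type*} [MeasurableSpace Ω] (μ : MeasureTheory.Measure Ω)
    (U : Ω → A) (V : Ω → B) : ℝ :=
  ProbabilityTheory.variance
    (fun ω => Real.log (1 / condProb μ U V (U ω) (V ω))) μ

/-- The first `n` variables of a process, as one random vector. -/
def firstVars {Ω A : Type*} (X : ℕ → Ω → A) (n : ℕ) : Ω → (Fin n → A) :=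
  fun ω i => X i ω

/-- `Z` is a Markov chain with initial distribution `P` and transition matrix `W`, where `W s s'`
is the probability `W(s|s')` of moving from `s'` to `s`. The chain starts at time `0`. -/
structure IsMarkovChain {Ω S : Type*} [MeasurableSpace Ω] [MeasurableSpace S]
    (μ : MeasureTheory.Measure Ω) (P : S → ℝ) (W : Matrix S S ℝ) (Z : ℕ → Ω → S) : Prop where
  measurable : ∀ i, Measurable (Z i)
  path_prob : ∀ (n : ℕ) (z : Fin (n + 1) → S),
    μ.real {ω | ∀ i : Fin (n + 1), Z i ω = z i} =
      P (z 0) * ∏ i : Fin n, W (z i.succ) (z i.castSucc)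

/-- `W` is non-hidden with respect to the second component, and `WY` is the resulting transition
matrix: `∑ x, W(x,y|x',y') = WY(y|y')` for all `x'`, `y`, `y'`. -/
def IsNonHidden {X Y : Type*} [Fintype X]
    (W : Matrix (X × Y) (X × Y) ℝ) (WY : Matrix Y Y ℝ) : Prop :=
  ∀ (x' : X) (y y' : Y), ∑ x, W (x, y) (x', y') = WY y y'

/-- The tilted matrix `W(x,y|x',y')^(1+θ) * WY(y|y')^(-θ)`. -/
def tilted {X Y : Type*} (W : Matrix (X × Y) (X × Y) ℝ) (WY : Matrix Y Y ℝ) (θ : ℝ) :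
    Matrix (X × Y) (X × Y) ℝ :=
  Matrix.of fun a b => W a b ^ (1 + θ) * WY a.2 b.2 ^ (-θ)

/-- The Perron–Frobenius eigenvalue of an irreducible nonnegative matrix: its spectral radius,
i.e. the largest modulus of a complex eigenvalue. -/
def perronFrobenius {S : Type*} [Fintype S] [DecidableEq S] (A : Matrix S S ℝ) : ℝ :=
  (spectralRadius ℂ (A.map (Complex.ofReal : ℝ → ℂ))).toReal

variable {X Y : Type*} [Fintype X] [DecidableEq X] [Fintype Y] [DecidableEq Y]

/-- The lower conditional Rényi entropy of order `1 + θ` for `W`, where `θ > -1`, `θ ≠ 0`. -/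
def lowerRenyi (W : Matrix (X × Y) (X × Y) ℝ) (WY : Matrix Y Y ℝ) (θ : ℝ) : ℝ :=
  -(1 / θ) * Real.log (perronFrobenius (tilted W WY θ))

/-- The conditional entropy `H^W(X|Y)`, the limit of `lowerRenyi` as `θ → 0`, `θ ≠ 0`. -/
def condEntropyW (W : Matrix (X × Y) (X × Y) ℝ) (WY : Matrix Y Y ℝ) : ℝ :=
  Filter.limUnder (nhdsWithin (0 : ℝ) {0}ᶜ) (lowerRenyi W WY)

/-- The quotient `2 [H^W(X|Y) - H_{1+θ}^{↓,W}(X|Y)] / θ`. -/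
def varQuotient (W : Matrix (X × Y) (X × Y) ℝ) (WY : Matrix Y Y ℝ) (θ : ℝ) : ℝ :=
  2 * (condEntropyW W WY - lowerRenyi W WY θ) / θ

/-- `V^W(X|Y)`, the limit of `varQuotient` as `θ → 0`, `θ ≠ 0`. -/
def varianceW (W : Matrix (X × Y) (X × Y) ℝ) (WY : Matrix Y Y ℝ) : ℝ :=
  Filter.limUnder (nhdsWithin (0 : ℝ) {0}ᶜ) (varQuotient W WY)

end MarkovVariance

end

/-!
Two Poisson equations drive the proof. Let `u` be the logarithm of `W(x,y|x',y') / W(y|y')`.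
Solving the first one makes `D(a,b) = u(a,b) - α + h(a) - h(b)` a martingale difference for the
chain; solving the second one makes the conditional mean of `D²` equal to a constant `v` up to a
coboundary `k(b) - (kW)(b)`.

On the spectral side, `exp(θ h + θ² k / 2)` is an eigenvector of the tilted matrix for the
eigenvalue `exp(θ α + θ² v / 2)` up to a relative error `o(θ²)`, so the Collatz–Wielandt bounds give
`log λ_θ = θ α + θ² v / 2 + o(θ²)`. Hence `H^W(X|Y) = -α` and `V^W(X|Y) = v`.

On the probabilistic side, `Y` is itself a Markov chain because `W` is non-hidden, so the
conditional log-likelihood of a path is the sum of `u` along its transitions plus a function of the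
initial state. It is therefore, up to a constant and bounded boundary terms, the martingale with
increments `D`, whose variance is `n v + O(1)`.
-/

namespace MarkovVariance

open Matrix Filter Topology Asymptotics MeasureTheory ProbabilityTheory

section Poisson

variable {S : Type*} [Fintype S]

/-- The unichain condition on a transition matrix: harmonic functions are constant. For a stochastic
matrix it says that there is exactly one recurrent class; transient states and periodicity are
allowed. -/
def IsUnichain (W : Matrix S S ℝ) : Prop :=
  ∀ h : S → ℝ, h ᵥ* W = h → ∀ a b, h a = h b

variable [DecidableEq S] {W : Matrix S S ℝ}

theorem sum_sub_mul_eq_sub_vecMul (hW : W ∈ colStochastic ℝ S) (h : S → ℝ) (m : ℝ) (b : S) :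
    ∑ a, (m - h a) * W a b = m - (h ᵥ* W) b := by
  simp only [sub_mul, Finset.sum_sub_distrib, ← Finset.mul_sum,
    sum_col_of_mem_colStochastic hW, mul_one, vecMul, dotProduct]

theorem vecMul_le_of_forall_le (hW : W ∈ colStochastic ℝ S) {h : S → ℝ} {m : ℝ}
    (hm : ∀ a, h a ≤ m) (b : S) : (h ᵥ* W) b ≤ m := by
  rw [← sub_nonneg, ← sum_sub_mul_eq_sub_vecMul hW]
  exact Finset.sum_nonneg fun a _ =>
    mul_nonneg (sub_nonneg.2 (hm a)) (nonneg_of_mem_colStochastic hW)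

theorem eq_of_vecMul_eq_of_forall_le (hW : W ∈ colStochastic ℝ S) {h : S → ℝ} {m : ℝ}
    (hm : ∀ a, h a ≤ m) {a b : S} (hb : (h ᵥ* W) b = m) (hab : 0 < W a b) : h a = m := by
  have hsum : ∑ a, (m - h a) * W a b = 0 := by
    rw [sum_sub_mul_eq_sub_vecMul hW, hb, sub_self]
  have hterm := (Finset.sum_eq_zero_iff_of_nonneg fun a _ =>
    mul_nonneg (sub_nonneg.2 (hm a)) (nonneg_of_mem_colStochastic hW)).1 hsum a (Finset.mem_univ a)
  exact (sub_eq_zero.1 ((mul_eq_zero.1 hterm).resolve_right hab.ne')).symm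

theorem vecMul_pow_eq_self {h : S → ℝ} (hh : h ᵥ* W = h) (n : ℕ) : h ᵥ* W ^ n = h := by
  induction n with
  | zero => rw [pow_zero, vecMul_one]
  | succ n ih => rw [pow_succ, ← vecMul_vecMul, ih, hh]

theorem isUnichain_of_isIrreducible (hW : W ∈ colStochastic ℝ S) (hirr : W.IsIrreducible) :
    IsUnichain W := by
  intro h hh a b
  have : Nonempty S := ⟨a⟩
  obtain ⟨m, hm⟩ := Finite.exists_max h
  suffices hmax : ∀ s, h s = h m from (hmax a).trans (hmax b).symm
  intro s
  obtain ⟨n, -, hn⟩ := (isIrreducible_iff_exists_pow_pos hirr.nonneg).1 hirr s m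
  exact eq_of_vecMul_eq_of_forall_le (pow_mem hW n) hm (congrFun (vecMul_pow_eq_self hh n) m) hn

theorem eq_zero_of_sub_vecMul_eq_const [Nonempty S] (hW : W ∈ colStochastic ℝ S) {h : S → ℝ}
    {c : ℝ} (hh : ∀ b, h b - (h ᵥ* W) b = c) : c = 0 := by
  have nonneg_of_coboundary : ∀ {h : S → ℝ} {c : ℝ}, (∀ b, h b - (h ᵥ* W) b = c) → 0 ≤ c := by
    intro h c hh
    obtain ⟨m, hm⟩ := Finite.exists_max h
    rw [← hh m]
    exact sub_nonneg.2 (vecMul_le_of_forall_le hW hm m)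
  refine le_antisymm ?_ (nonneg_of_coboundary hh)
  refine neg_nonneg.1 (nonneg_of_coboundary (h := -h) fun b => ?_)
  rw [neg_vecMul, Pi.neg_apply, Pi.neg_apply, ← hh b]
  ring

/-- Adding the value at a fixed state to `h - h W` makes it an injective, hence surjective,
endomorphism of the space of functions. -/
theorem IsUnichain.exists_poisson [Nonempty S] (hU : IsUnichain W) (hW : W ∈ colStochastic ℝ S)
    (g : S → ℝ) : ∃ (c : ℝ) (h : S → ℝ), ∀ b, g b = c + h b - (h ᵥ* W) b := by
  obtain ⟨s⟩ := ‹Nonempty S›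
  have : Nonempty S := ⟨s⟩
  let L : (S → ℝ) →ₗ[ℝ] (S → ℝ) :=
    LinearMap.id - W.vecMulLinear + LinearMap.pi fun _ => LinearMap.proj s
  have L_apply : ∀ h b, L h b = h b - (h ᵥ* W) b + h s := fun h b => rfl
  have injective_L : Function.Injective L := by
    rw [injective_iff_map_eq_zero]
    intro h hLh
    have coboundary_eq : ∀ b, h b - (h ᵥ* W) b = -h s := fun b =>
      eq_neg_of_add_eq_zero_left (congrFun hLh b)
    have value_eq_zero : h s = 0 := neg_eq_zero.1 (eq_zero_of_sub_vecMul_eq_const hW coboundary_eq)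
    have harmonic : h ᵥ* W = h := funext fun b =>
      (sub_eq_zero.1 ((coboundary_eq b).trans (by rw [value_eq_zero, neg_zero]))).symm
    exact funext fun b => (hU h harmonic b s).trans value_eq_zero
  obtain ⟨h, hh⟩ := LinearMap.injective_iff_surjective.1 injective_L g
  refine ⟨h s, h, fun b => ?_⟩
  rw [← hh, L_apply]
  ring

end Poisson

section CollatzWielandt

variable {S : Type*} [Fintype S] {A : Matrix S S ℝ} {v : S → ℝ} {c : ℝ}

theorem norm_mul_norm_le_mulVec_norm (hA : ∀ a b, 0 ≤ A a b) {z : ℂ} {w : S → ℂ}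
    (hw : A.map Complex.ofReal *ᵥ w = z • w) (a : S) :
    ‖z‖ * ‖w a‖ ≤ (A *ᵥ fun b => ‖w b‖) a := by
  calc ‖z‖ * ‖w a‖ = ‖∑ b, (A a b : ℂ) * w b‖ := by
        rw [← norm_mul, ← smul_eq_mul, ← Pi.smul_apply, ← hw]
        rfl
    _ ≤ ∑ b, ‖(A a b : ℂ) * w b‖ := norm_sum_le _ _
    _ = (A *ᵥ fun b => ‖w b‖) a := Finset.sum_congr rfl fun b _ => by
        rw [norm_mul, Complex.norm_real, Real.norm_of_nonneg (hA a b)]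

theorem norm_eigenvalue_le_of_vecMul_le (hA : ∀ a b, 0 ≤ A a b) (hv : ∀ b, 0 < v b)
    (h : v ᵥ* A ≤ c • v) {z : ℂ} {w : S → ℂ} (hw0 : w ≠ 0)
    (hw : A.map Complex.ofReal *ᵥ w = z • w) : ‖z‖ ≤ c := by
  obtain ⟨s, hs⟩ := Function.ne_iff.1 hw0
  have hpos : 0 < v ⬝ᵥ fun b => ‖w b‖ :=
    Finset.sum_pos' (fun b _ => mul_nonneg (hv b).le (norm_nonneg _))
      ⟨s, Finset.mem_univ s, mul_pos (hv s) (norm_pos_iff.2 hs)⟩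
  refine le_of_mul_le_mul_right ?_ hpos
  calc ‖z‖ * (v ⬝ᵥ fun b => ‖w b‖) = v ⬝ᵥ (‖z‖ • fun b => ‖w b‖) := by
        rw [dotProduct_smul, smul_eq_mul]
    _ ≤ v ⬝ᵥ (A *ᵥ fun b => ‖w b‖) := dotProduct_le_dotProduct_of_nonneg_left
        (norm_mul_norm_le_mulVec_norm hA hw) fun b => (hv b).le
    _ = (v ᵥ* A) ⬝ᵥ fun b => ‖w b‖ := dotProduct_mulVec _ _ _
    _ ≤ (c • v) ⬝ᵥ fun b => ‖w b‖ :=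
        dotProduct_le_dotProduct_of_nonneg_right h fun b => norm_nonneg _
    _ = c * (v ⬝ᵥ fun b => ‖w b‖) := by rw [smul_dotProduct, smul_eq_mul]

variable [DecidableEq S]

theorem spectralRadius_le_of_vecMul_le (hA : ∀ a b, 0 ≤ A a b) (hv : ∀ b, 0 < v b)
    (h : v ᵥ* A ≤ c • v) : spectralRadius ℂ (A.map Complex.ofReal) ≤ ENNReal.ofReal c := by
  refine iSup₂_le fun z hz => ?_
  rw [← spectrum_toLin', ← Module.End.hasEigenvalue_iff_mem_spectrum] at hz
  obtain ⟨w, hw⟩ := hz.exists_hasEigenvector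
  have hAw : A.map Complex.ofReal *ᵥ w = z • w := by
    rw [← toLin'_apply, hw.apply_eq_smul]
  rw [← enorm_eq_nnnorm, ← ofReal_norm]
  exact ENNReal.ofReal_le_ofReal (norm_eigenvalue_le_of_vecMul_le hA hv h hw.2 hAw)

theorem pow_smul_le_vecMul_pow (hA : ∀ a b, 0 ≤ A a b) (hc : 0 ≤ c) (h : c • v ≤ v ᵥ* A) (n : ℕ) :
    c ^ n • v ≤ v ᵥ* A ^ n := by
  induction n with
  | zero => rw [pow_zero, pow_zero, one_smul, vecMul_one]
  | succ n ih =>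
    calc c ^ (n + 1) • v = c ^ n • c • v := by rw [pow_succ, mul_smul]
      _ ≤ c ^ n • (v ᵥ* A) := smul_le_smul_of_nonneg_left h (pow_nonneg hc n)
      _ = (c ^ n • v) ᵥ* A := (smul_vecMul _ _ _).symm
      _ ≤ (v ᵥ* A ^ n) ᵥ* A := fun b =>
          dotProduct_le_dotProduct_of_nonneg_right ih fun a => hA a b
      _ = v ᵥ* A ^ (n + 1) := by rw [vecMul_vecMul, pow_succ]

theorem le_spectralRadius_of_forall_pow_le_norm_pow {R : Type*} [NormedRing R] [NormedAlgebra ℂ R]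
    [CompleteSpace R] {a : R} (hc : 0 ≤ c) (h : ∀ n, c ^ n ≤ ‖a ^ n‖) :
    ENNReal.ofReal c ≤ spectralRadius ℂ a := by
  refine ge_of_tendsto (spectrum.pow_norm_pow_one_div_tendsto_nhds_spectralRadius a) ?_
  filter_upwards [eventually_ne_atTop 0] with n hn
  refine ENNReal.ofReal_le_ofReal ?_
  calc c = (c ^ n) ^ (1 / n : ℝ) := by rw [one_div, Real.pow_rpow_inv_natCast hc hn]
    _ ≤ ‖a ^ n‖ ^ (1 / n : ℝ) := Real.rpow_le_rpow (pow_nonneg hc n) (h n) (by positivity)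

attribute [local instance] Matrix.linftyOpNormedRing Matrix.linftyOpNormedAlgebra

theorem norm_map_ofReal (A : Matrix S S ℝ) : ‖A.map Complex.ofReal‖ = ‖A‖ := by
  simp [linfty_opNorm_def]

theorem mulVec_one_le_norm (A : Matrix S S ℝ) (a : S) : (A *ᵥ 1) a ≤ ‖A‖ := by
  have : Nonempty S := ⟨a⟩
  calc (A *ᵥ 1) a ≤ ‖A *ᵥ 1‖ := (Real.le_norm_self _).trans (norm_le_pi_norm _ a)
    _ ≤ ‖A‖ * ‖(1 : S → ℝ)‖ := linfty_opNorm_mulVec A 1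
    _ = ‖A‖ := by rw [norm_one, mul_one]

theorem le_norm_of_smul_le_vecMul [Nonempty S] (hv : ∀ b, 0 < v b) (h : c • v ≤ v ᵥ* A) :
    c ≤ ‖A‖ := by
  have hpos : 0 < v ⬝ᵥ 1 := by
    rw [dotProduct_one]
    exact Finset.sum_pos (fun b _ => hv b) Finset.univ_nonempty
  refine le_of_mul_le_mul_right ?_ hpos
  calc c * (v ⬝ᵥ 1) = (c • v) ⬝ᵥ 1 := by rw [smul_dotProduct, smul_eq_mul]
    _ ≤ (v ᵥ* A) ⬝ᵥ 1 := dotProduct_le_dotProduct_of_nonneg_right h zero_le_one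
    _ = v ⬝ᵥ (A *ᵥ 1) := (dotProduct_mulVec _ _ _).symm
    _ ≤ v ⬝ᵥ (‖A‖ • 1) := dotProduct_le_dotProduct_of_nonneg_left
        (fun a => by simpa using mulVec_one_le_norm A a) fun b => (hv b).le
    _ = ‖A‖ * (v ⬝ᵥ 1) := by rw [dotProduct_smul, smul_eq_mul]

theorem le_spectralRadius_of_smul_le_vecMul [Nonempty S] (hA : ∀ a b, 0 ≤ A a b)
    (hv : ∀ b, 0 < v b) (h : c • v ≤ v ᵥ* A) :
    ENNReal.ofReal c ≤ spectralRadius ℂ (A.map Complex.ofReal) := by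
  rcases le_total c 0 with hc | hc
  · simp [ENNReal.ofReal_of_nonpos hc]
  refine le_spectralRadius_of_forall_pow_le_norm_pow hc fun n => ?_
  have map_pow_eq : A.map Complex.ofReal ^ n = (A ^ n).map Complex.ofReal :=
    (map_pow Complex.ofRealHom.mapMatrix A n).symm
  rw [map_pow_eq, norm_map_ofReal]
  exact le_norm_of_smul_le_vecMul hv (pow_smul_le_vecMul_pow hA hc h n)

theorem abs_perronFrobenius_sub_le [Nonempty S] (hA : ∀ a b, 0 ≤ A a b) (hv : ∀ b, 0 < v b)
    {r δ : ℝ} (h : ∀ b, |(v ᵥ* A) b - r * v b| ≤ δ * v b) : |perronFrobenius A - r| ≤ δ := by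
  have upper : v ᵥ* A ≤ (r + δ) • v := fun b => by
    rw [Pi.smul_apply, smul_eq_mul]
    linarith [(abs_le.1 (h b)).2]
  have lower : (r - δ) • v ≤ v ᵥ* A := fun b => by
    rw [Pi.smul_apply, smul_eq_mul]
    linarith [(abs_le.1 (h b)).1]
  have radius_le := spectralRadius_le_of_vecMul_le hA hv upper
  have le_radius := (ENNReal.ofReal_le_iff_le_toReal
    (ne_top_of_le_ne_top ENNReal.ofReal_ne_top radius_le)).1
    (le_spectralRadius_of_smul_le_vecMul hA hv lower)
  have sum_nonneg : 0 ≤ r + δ := by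
    obtain ⟨s⟩ := ‹Nonempty S›
    refine nonneg_of_mul_nonneg_left ?_ (hv s)
    exact (dotProduct_nonneg_of_nonneg (fun a => (hv a).le) fun a => hA a s).trans (upper s)
  rw [abs_sub_le_iff, perronFrobenius]
  constructor
  · linarith [ENNReal.toReal_le_of_le_ofReal sum_nonneg radius_le]
  · linarith

end CollatzWielandt

section Expansion

variable {S : Type*}

/-- The increment `u - α` of an additive functional corrected by the increment of `h`. When `h`
solves the Poisson equation of `u`, these are the differences of a martingale. -/
def martingaleDiff (u : S → S → ℝ) (α : ℝ) (h : S → ℝ) (a b : S) : ℝ :=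
  u a b - α + h a - h b

/-- The matrix `W` with the weight of each transition multiplied by `exp (θ u)`. -/
noncomputable def expTilt (W : Matrix S S ℝ) (u : S → S → ℝ) (θ : ℝ) : Matrix S S ℝ :=
  of fun a b => W a b * Real.exp (θ * u a b)

/-- The left eigenvector of `expTilt W u θ` up to a relative error `o(θ²)`. -/
noncomputable def approxEigenvector (h k : S → ℝ) (θ : ℝ) (a : S) : ℝ :=
  Real.exp (θ * h a + θ ^ 2 * (k a / 2))

variable {W : Matrix S S ℝ} {u : S → S → ℝ} {α v : ℝ} {h k : S → ℝ}

theorem expTilt_nonneg (hW : ∀ a b, 0 ≤ W a b) (u : S → S → ℝ) (θ : ℝ) (a b : S) :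
    0 ≤ expTilt W u θ a b :=
  mul_nonneg (hW a b) (Real.exp_nonneg _)

theorem approxEigenvector_pos (h k : S → ℝ) (θ : ℝ) (b : S) : 0 < approxEigenvector h k θ b :=
  Real.exp_pos _

theorem exp_sub_quadratic_isLittleO (x y : ℝ) :
    (fun θ : ℝ => Real.exp (θ * x + θ ^ 2 * y) - (1 + θ * x + θ ^ 2 * (x ^ 2 / 2 + y)))
      =o[𝓝 0] fun θ => θ ^ 2 := by
  have exponent_tendsto : Tendsto (fun θ : ℝ => θ * x + θ ^ 2 * y) (𝓝 0) (𝓝 0) := by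
    have : Continuous fun θ : ℝ => θ * x + θ ^ 2 * y := by fun_prop
    simpa using this.tendsto 0
  have exponent_isBigO : (fun θ : ℝ => θ * x + θ ^ 2 * y) =O[𝓝 0] fun θ => θ := by
    have : Tendsto (fun θ : ℝ => x + θ * y) (𝓝 0) (𝓝 (x + 0 * y)) :=
      tendsto_const_nhds.add (tendsto_id.mul_const y)
    refine ((isBigO_refl _ _).mul (this.isBigO_one ℝ)).congr (fun θ => ?_) fun θ => mul_one θ
    ring
  have exp_taylor := ((Real.exp_sub_sum_range_succ_isLittleO_pow 2).comp_tendsto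
    exponent_tendsto).trans_isBigO (exponent_isBigO.pow 2)
  have higher_order : (fun θ : ℝ => θ ^ 3 * (x * y + θ * (y ^ 2 / 2))) =o[𝓝 0] fun θ => θ ^ 2 := by
    have : Tendsto (fun θ : ℝ => x * y + θ * (y ^ 2 / 2)) (𝓝 0) (𝓝 (x * y + 0 * (y ^ 2 / 2))) :=
      tendsto_const_nhds.add (tendsto_id.mul_const _)
    simpa using (isLittleO_pow_pow (𝕜 := ℝ) (by norm_num : 2 < 3)).mul_isBigO (this.isBigO_one ℝ)
  refine (exp_taylor.add higher_order).congr_left fun θ => ?_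
  simp only [Function.comp_apply, Finset.sum_range_succ, Finset.sum_range_zero, Nat.factorial]
  push_cast
  ring

variable [Fintype S]

/-- The conditional mean of `f` over one step: the expectation of `f Z₁ Z₀` given `Z₀ = b`, where
`W a b` is the probability of moving from `b` to `a`. -/
def stepMean (W : Matrix S S ℝ) (f : S → S → ℝ) (b : S) : ℝ :=
  ∑ a, W a b * f a b

/-- `α` and `h` turn the additive functional `u` into a martingale, whose conditional variance has
the mean `v` up to the coboundary of `k`. -/
structure IsMartingaleDecomposition (W : Matrix S S ℝ) (u : S → S → ℝ) (α v : ℝ) (h k : S → ℝ) :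
    Prop where
  stepMean_eq_zero : ∀ b, stepMean W (martingaleDiff u α h) b = 0
  stepMean_sq : ∀ b, stepMean W (fun a b => martingaleDiff u α h a b ^ 2) b =
    v + k b - (k ᵥ* W) b

theorem stepMean_fst (W : Matrix S S ℝ) (k : S → ℝ) (b : S) :
    stepMean W (fun a _ => k a) b = (k ᵥ* W) b :=
  Finset.sum_congr rfl fun _ _ => mul_comm _ _

theorem stepMean_linear (W : Matrix S S ℝ) (c d : ℝ) (f g : S → S → ℝ) (b : S) :
    stepMean W (fun a b => c * f a b + d * g a b) b = c * stepMean W f b + d * stepMean W g b := by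
  simp only [stepMean, Finset.mul_sum, ← Finset.sum_add_distrib]
  exact Finset.sum_congr rfl fun _ _ => by ring

theorem vecMul_expTilt_approxEigenvector (W : Matrix S S ℝ) (u : S → S → ℝ) (α v : ℝ)
    (h k : S → ℝ) (θ : ℝ) (b : S) :
    (approxEigenvector h k θ ᵥ* expTilt W u θ) b =
      Real.exp (α * θ + v / 2 * θ ^ 2) * approxEigenvector h k θ b *
        stepMean W (fun a b => Real.exp
          (θ * martingaleDiff u α h a b + θ ^ 2 * ((k a - k b - v) / 2))) b := by
  simp only [vecMul, dotProduct, stepMean, expTilt, approxEigenvector, of_apply, Finset.mul_sum,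
    ← Real.exp_add]
  refine Finset.sum_congr rfl fun a _ => ?_
  rw [mul_left_comm, ← Real.exp_add, mul_left_comm, ← Real.exp_add, martingaleDiff]
  ring_nf

variable [DecidableEq S]

theorem stepMean_coboundary (hW : W ∈ colStochastic ℝ S) (k : S → ℝ) (v : ℝ) (b : S) :
    stepMean W (fun a b => k a - k b - v) b = (k ᵥ* W) b - k b - v := by
  rw [← sub_add_eq_sub_sub, ← neg_sub, ← sum_sub_mul_eq_sub_vecMul hW, stepMean,
    ← Finset.sum_neg_distrib]
  exact Finset.sum_congr rfl fun _ _ => by ring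

theorem IsUnichain.exists_isMartingaleDecomposition [Nonempty S] (hU : IsUnichain W)
    (hW : W ∈ colStochastic ℝ S) (u : S → S → ℝ) :
    ∃ α v h k, IsMartingaleDecomposition W u α v h k := by
  obtain ⟨α, h, poisson_u⟩ := hU.exists_poisson hW (stepMean W u)
  obtain ⟨v, k, poisson_sq⟩ :=
    hU.exists_poisson hW (stepMean W fun a b => martingaleDiff u α h a b ^ 2)
  refine ⟨α, v, h, k, fun b => ?_, poisson_sq⟩
  calc stepMean W (martingaleDiff u α h) b
      = stepMean W (fun a b => 1 * u a b + 1 * (h a - h b - α)) b := by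
        congr 1
        funext a b
        rw [martingaleDiff]
        ring
    _ = stepMean W u b + ((h ᵥ* W) b - h b - α) := by
        rw [stepMean_linear, stepMean_coboundary hW, one_mul, one_mul]
    _ = 0 := by
        rw [poisson_u b]
        ring

theorem stepMean_exp_sub_one_isLittleO (hW : W ∈ colStochastic ℝ S) {x y : S → S → ℝ} {b : S}
    (hx : stepMean W x b = 0) (hxy : stepMean W (fun a b => x a b ^ 2 / 2 + y a b) b = 0) :
    (fun θ : ℝ => stepMean W (fun a b => Real.exp (θ * x a b + θ ^ 2 * y a b)) b - 1)
      =o[𝓝 0] fun θ => θ ^ 2 := by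
  have weighted_sum := IsLittleO.fun_sum (s := Finset.univ) fun a _ =>
    (exp_sub_quadratic_isLittleO (x a b) (y a b)).const_mul_left (W a b)
  refine weighted_sum.congr_left fun θ => ?_
  have quadratic_mean : ∑ a, W a b * (1 + θ * x a b + θ ^ 2 * (x a b ^ 2 / 2 + y a b)) = 1 := by
    calc _ = ∑ a, W a b + θ * stepMean W x b +
          θ ^ 2 * stepMean W (fun a b => x a b ^ 2 / 2 + y a b) b := by
          simp only [stepMean, Finset.mul_sum, ← Finset.sum_add_distrib]
          exact Finset.sum_congr rfl fun _ _ => by ring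
      _ = 1 := by rw [hx, hxy, sum_col_of_mem_colStochastic hW]; ring
  simp only [mul_sub, Finset.sum_sub_distrib, quadratic_mean, stepMean]

namespace IsMartingaleDecomposition

theorem stepMean_exp_sub_one_isLittleO (E : IsMartingaleDecomposition W u α v h k)
    (hW : W ∈ colStochastic ℝ S) (b : S) :
    (fun θ : ℝ => stepMean W (fun a b => Real.exp
      (θ * martingaleDiff u α h a b + θ ^ 2 * ((k a - k b - v) / 2))) b - 1)
      =o[𝓝 0] fun θ => θ ^ 2 := by
  refine MarkovVariance.stepMean_exp_sub_one_isLittleO hW (E.stepMean_eq_zero b) ?_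
  calc stepMean W (fun a b => martingaleDiff u α h a b ^ 2 / 2 + (k a - k b - v) / 2) b
      = stepMean W (fun a b =>
          1 / 2 * martingaleDiff u α h a b ^ 2 + 1 / 2 * (k a - k b - v)) b := by
        congr 1
        funext a b
        ring
    _ = 0 := by
        rw [stepMean_linear, E.stepMean_sq, stepMean_coboundary hW]
        ring

theorem perronFrobenius_div_sub_one_isLittleO [Nonempty S]
    (E : IsMartingaleDecomposition W u α v h k) (hW : W ∈ colStochastic ℝ S) :
    (fun θ => perronFrobenius (expTilt W u θ) / Real.exp (α * θ + v / 2 * θ ^ 2) - 1)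
      =o[𝓝 0] fun θ => θ ^ 2 := by
  refine isLittleO_iff.2 fun ε hε => ?_
  have eventually_small := eventually_all.2 fun b =>
    isLittleO_iff.1 (E.stepMean_exp_sub_one_isLittleO hW b) hε
  filter_upwards [eventually_small] with θ small
  have r_pos := Real.exp_pos (α * θ + v / 2 * θ ^ 2)
  rw [div_sub_one r_pos.ne', norm_div, Real.norm_of_nonneg r_pos.le, div_le_iff₀ r_pos]
  refine abs_perronFrobenius_sub_le (expTilt_nonneg (fun a b => nonneg_of_mem_colStochastic hW) u θ)
    (approxEigenvector_pos h k θ) fun b => ?_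
  have eigenvector_pos := approxEigenvector_pos h k θ b
  rw [vecMul_expTilt_approxEigenvector W u α v, ← mul_sub_one, abs_mul,
    abs_of_pos (mul_pos r_pos eigenvector_pos), mul_comm, mul_assoc (ε * ‖θ ^ 2‖)]
  exact mul_le_mul_of_nonneg_right (small b) (mul_pos r_pos eigenvector_pos).le

theorem log_perronFrobenius_isLittleO [Nonempty S] (E : IsMartingaleDecomposition W u α v h k)
    (hW : W ∈ colStochastic ℝ S) :
    (fun θ => Real.log (perronFrobenius (expTilt W u θ)) - (α * θ + v / 2 * θ ^ 2))
      =o[𝓝 0] fun θ => θ ^ 2 := by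
  have ratio := E.perronFrobenius_div_sub_one_isLittleO hW
  have ratio_tendsto : Tendsto
      (fun θ => perronFrobenius (expTilt W u θ) / Real.exp (α * θ + v / 2 * θ ^ 2))
      (𝓝 0) (𝓝 1) := by
    rw [← tendsto_sub_nhds_zero_iff]
    refine ratio.trans_tendsto ?_
    simpa using (continuous_pow 2).tendsto (0 : ℝ)
  have log_ratio := ((Real.hasDerivAt_log one_ne_zero).isBigO_sub.comp_tendsto
    ratio_tendsto).trans_isLittleO ratio
  refine log_ratio.congr' ?_ EventuallyEq.rfl
  filter_upwards [ratio_tendsto.eventually_ne one_ne_zero] with θ ne_zero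
  rw [Function.comp_apply, Real.log_one, sub_zero, Real.log_div (div_ne_zero_iff.1 ne_zero).1
    (Real.exp_pos _).ne', Real.log_exp]

end IsMartingaleDecomposition

end Expansion

section Renyi

variable {X Y : Type*}

/-- The conditional log-likelihood `log W(x,y|x',y') - log WY(y|y')` of one transition. -/
noncomputable def logRatio (W : Matrix (X × Y) (X × Y) ℝ) (WY : Matrix Y Y ℝ) (a b : X × Y) : ℝ :=
  Real.log (W a b) - Real.log (WY a.2 b.2)

variable [Fintype X] {W : Matrix (X × Y) (X × Y) ℝ} {WY : Matrix Y Y ℝ}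

theorem IsNonHidden.le (hWY : IsNonHidden W WY) (hW : ∀ a b, 0 ≤ W a b) (a b : X × Y) :
    W a b ≤ WY a.2 b.2 := by
  rw [← hWY b.1 a.2 b.2]
  exact Finset.single_le_sum (f := fun x => W (x, a.2) b) (fun x _ => hW _ _)
    (Finset.mem_univ a.1)

theorem IsNonHidden.tilted_eq_expTilt (hWY : IsNonHidden W WY) (hW : ∀ a b, 0 ≤ W a b) {θ : ℝ}
    (hθ : -1 < θ) : tilted W WY θ = expTilt W (logRatio W WY) θ := by
  ext a b
  rw [tilted, expTilt, of_apply, of_apply, logRatio]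
  rcases (hW a b).eq_or_lt with hab | hab
  · rw [← hab, Real.zero_rpow (by linarith), zero_mul, zero_mul]
  · rw [Real.rpow_one_add' hab.le (by linarith), Real.rpow_def_of_pos hab,
      Real.rpow_def_of_pos (hab.trans_le (hWY.le hW a b)), mul_assoc, ← Real.exp_add]
    ring_nf

variable [Fintype Y] [DecidableEq X] [DecidableEq Y] {α v : ℝ} {h k : X × Y → ℝ}

namespace IsMartingaleDecomposition

theorem log_tilted_isLittleO [Nonempty (X × Y)]
    (E : IsMartingaleDecomposition W (logRatio W WY) α v h k) (hW : W ∈ colStochastic ℝ (X × Y))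
    (hWY : IsNonHidden W WY) :
    (fun θ => Real.log (perronFrobenius (tilted W WY θ)) - (α * θ + v / 2 * θ ^ 2))
      =o[𝓝 0] fun θ => θ ^ 2 := by
  refine (E.log_perronFrobenius_isLittleO hW).congr' ?_ EventuallyEq.rfl
  filter_upwards [lt_mem_nhds neg_one_lt_zero] with θ hθ
  rw [hWY.tilted_eq_expTilt (fun a b => nonneg_of_mem_colStochastic hW) hθ]

theorem tendsto_lowerRenyi [Nonempty (X × Y)]
    (E : IsMartingaleDecomposition W (logRatio W WY) α v h k) (hW : W ∈ colStochastic ℝ (X × Y))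
    (hWY : IsNonHidden W WY) : Tendsto (lowerRenyi W WY) (𝓝[≠] 0) (𝓝 (-α)) := by
  have remainder := (E.log_tilted_isLittleO hW hWY).tendsto_div_nhds_zero.mono_left
    (nhdsWithin_le_nhds (s := {0}ᶜ))
  have id_tendsto : Tendsto (fun θ : ℝ => θ) (𝓝[≠] 0) (𝓝 0) := nhdsWithin_le_nhds
  have limit := (((remainder.add_const (v / 2)).mul id_tendsto).add_const α).neg
  rw [mul_zero, zero_add] at limit
  refine limit.congr' ?_
  filter_upwards [self_mem_nhdsWithin] with θ hθ
  have hθ : θ ≠ 0 := hθ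
  rw [lowerRenyi]
  field_simp
  ring

theorem condEntropyW_eq [Nonempty (X × Y)]
    (E : IsMartingaleDecomposition W (logRatio W WY) α v h k) (hW : W ∈ colStochastic ℝ (X × Y))
    (hWY : IsNonHidden W WY) : condEntropyW W WY = -α :=
  (E.tendsto_lowerRenyi hW hWY).limUnder_eq

theorem tendsto_varQuotient [Nonempty (X × Y)]
    (E : IsMartingaleDecomposition W (logRatio W WY) α v h k) (hW : W ∈ colStochastic ℝ (X × Y))
    (hWY : IsNonHidden W WY) : Tendsto (varQuotient W WY) (𝓝[≠] 0) (𝓝 v) := by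
  have remainder := (E.log_tilted_isLittleO hW hWY).tendsto_div_nhds_zero.mono_left
    (nhdsWithin_le_nhds (s := {0}ᶜ))
  have limit := (remainder.const_mul 2).add_const v
  rw [mul_zero, zero_add] at limit
  refine limit.congr' ?_
  filter_upwards [self_mem_nhdsWithin] with θ hθ
  have hθ : θ ≠ 0 := hθ
  rw [varQuotient, E.condEntropyW_eq hW hWY, lowerRenyi]
  field_simp
  ring

theorem varianceW_eq [Nonempty (X × Y)]
    (E : IsMartingaleDecomposition W (logRatio W WY) α v h k) (hW : W ∈ colStochastic ℝ (X × Y))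
    (hWY : IsNonHidden W WY) : varianceW W WY = v :=
  (E.tendsto_varQuotient hW hWY).limUnder_eq

end IsMartingaleDecomposition

end Renyi

section Variance

variable {Ω : Type*} [MeasurableSpace Ω] {μ : Measure Ω}

theorem covariance_sq_le [IsFiniteMeasure μ] {R M : Ω → ℝ} (hR : MemLp R 2 μ) (hM : MemLp M 2 μ) :
    cov[R, M; μ] ^ 2 ≤ Var[R; μ] * Var[M; μ] := by
  have variance_quadratic : ∀ t : ℝ,
      0 ≤ Var[R; μ] * (t * t) + -2 * cov[R, M; μ] * t + Var[M; μ] := by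
    intro t
    have := variance_nonneg (fun ω => t * R ω - M ω) μ
    rw [variance_fun_sub (hR.const_mul t) hM, variance_const_mul, covariance_const_mul_left] at this
    linarith
  have := discrim_le_zero variance_quadratic
  rw [discrim] at this
  linarith

theorem tendsto_variance_sub_div [IsFiniteMeasure μ] {ι : Type*} {l : Filter ι} {R M : ι → Ω → ℝ}
    {c : ι → ℝ} {v : ℝ} (hR : ∀ i, MemLp (R i) 2 μ) (hM : ∀ i, MemLp (M i) 2 μ)
    (hR_lim : Tendsto (fun i => Var[R i; μ] / c i) l (𝓝 0))
    (hM_lim : Tendsto (fun i => Var[M i; μ] / c i) l (𝓝 v)) :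
    Tendsto (fun i => Var[fun ω => R i ω - M i ω; μ] / c i) l (𝓝 v) := by
  have covariance_lim : Tendsto (fun i => cov[R i, M i; μ] / c i) l (𝓝 0) := by
    refine squeeze_zero_norm (a := fun i => √(Var[R i; μ] / c i * (Var[M i; μ] / c i)))
      (fun i => Real.abs_le_sqrt ?_) ?_
    · rw [div_pow, div_mul_div_comm, ← sq]
      exact div_le_div_of_nonneg_right (covariance_sq_le (hR i) (hM i)) (sq_nonneg _)
    · simpa using (hR_lim.mul hM_lim).sqrt
  have limit := (hR_lim.sub (covariance_lim.const_mul 2)).add hM_lim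
  rw [mul_zero, sub_zero, zero_add] at limit
  refine limit.congr fun i => ?_
  rw [variance_fun_sub (hR i) (hM i)]
  ring

variable {T : Type*} [MeasurableSpace T] [MeasurableSingletonClass T]

theorem memLp_comp_of_finite [Finite T] [IsFiniteMeasure μ] {V : Ω → T} (hV : Measurable V)
    (g : T → ℝ) : MemLp (fun ω => g (V ω)) 2 μ :=
  MemLp.of_discrete.comp_of_map hV.aemeasurable

theorem exists_forall_variance_comp_le [Finite T] [IsProbabilityMeasure μ] (g : T → ℝ) :
    ∃ K, ∀ V : Ω → T, Measurable V → Var[fun ω => g (V ω); μ] ≤ K := by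
  obtain ⟨C, hC⟩ := Finite.exists_le fun t => |g t|
  exact ⟨((C - -C) / 2) ^ 2, fun V hV => variance_le_sq_of_bounded
    (ae_of_all _ fun ω => abs_le.1 (hC (V ω)))
    (memLp_comp_of_finite hV g).aestronglyMeasurable.aemeasurable⟩

theorem ae_measureReal_preimage_ne_zero [Countable T] [IsFiniteMeasure μ] {V : Ω → T}
    (hV : Measurable V) : ∀ᵐ ω ∂μ, μ.real (V ⁻¹' {V ω}) ≠ 0 := by
  refine ae_of_ae_map (p := fun t => μ.real (V ⁻¹' {t}) ≠ 0) hV.aemeasurable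
    (ae_iff_of_countable.2 fun t ht => ?_)
  rwa [Measure.map_apply hV (measurableSet_singleton t), ← measureReal_ne_zero_iff] at ht

end Variance

section PathWeight

variable {S : Type*}

/-- The probability which the initial distribution `P` and the transition matrix `W` assign to the
path `z`. -/
def pathWeight (P : S → ℝ) (W : Matrix S S ℝ) {n : ℕ} (z : Fin (n + 1) → S) : ℝ :=
  P (z 0) * ∏ i : Fin n, W (z i.succ) (z i.castSucc)

theorem pathWeight_succ (P : S → ℝ) (W : Matrix S S ℝ) {n : ℕ} (z : Fin (n + 2) → S) :
    pathWeight P W z = pathWeight P W (Fin.init z) *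
      W (z (Fin.last (n + 1))) (z (Fin.last n).castSucc) := by
  rw [pathWeight, Fin.prod_univ_castSucc, ← mul_assoc]
  rfl

theorem log_pathWeight {P : S → ℝ} {W : Matrix S S ℝ} {n : ℕ} {z : Fin (n + 1) → S}
    (hz : pathWeight P W z ≠ 0) : Real.log (pathWeight P W z) =
      Real.log (P (z 0)) + ∑ i : Fin n, Real.log (W (z i.succ) (z i.castSucc)) := by
  obtain ⟨initial_ne, steps_ne⟩ := mul_ne_zero_iff.1 hz
  rw [pathWeight, Real.log_mul initial_ne steps_ne,
    Real.log_prod (Finset.prod_ne_zero_iff.1 steps_ne)]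

theorem sum_snoc {M : Type*} [AddCommMonoid M] [Fintype S] {n : ℕ} (f : (Fin (n + 1) → S) → M) :
    ∑ z, f z = ∑ z : Fin n → S, ∑ a, f (Fin.snoc (α := fun _ => S) z a) := by
  rw [← (Fin.snocEquiv fun _ => S).sum_comp, Fintype.sum_prod_type_right]
  rfl

end PathWeight

section Chain

variable {Ω S : Type*}

theorem setOf_forall_eq_preimage_firstVars (Z : ℕ → Ω → S) (n : ℕ) (z : Fin n → S) :
    {ω | ∀ i : Fin n, Z i ω = z i} = firstVars Z n ⁻¹' {z} :=
  Set.ext fun _ => funext_iff.symm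

variable [MeasurableSpace Ω] [MeasurableSpace S] {μ : Measure Ω} {P : S → ℝ} {W : Matrix S S ℝ}
  {Z : ℕ → Ω → S}

theorem measurable_firstVars (hZ : ∀ i, Measurable (Z i)) (n : ℕ) : Measurable (firstVars Z n) :=
  measurable_pi_lambda _ fun i => hZ i

namespace IsMarkovChain

theorem measureReal_firstVars_preimage (hZ : IsMarkovChain μ P W Z) {n : ℕ} (z : Fin (n + 1) → S) :
    μ.real (firstVars Z (n + 1) ⁻¹' {z}) = pathWeight P W z := by
  rw [← setOf_forall_eq_preimage_firstVars, hZ.path_prob, pathWeight]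

variable [MeasurableSingletonClass S]

section Finite

variable [Finite S] [IsFiniteMeasure μ]

theorem ae_pathWeight_ne_zero (hZ : IsMarkovChain μ P W Z) (n : ℕ) :
    ∀ᵐ ω ∂μ, pathWeight P W (firstVars Z (n + 1) ω) ≠ 0 := by
  filter_upwards [ae_measureReal_preimage_ne_zero (μ := μ)
    (measurable_firstVars hZ.measurable (n + 1))] with ω hω
  rwa [hZ.measureReal_firstVars_preimage] at hω

theorem memLp_comp (hZ : IsMarkovChain μ P W Z) (i : ℕ) (g : S → ℝ) :
    MemLp (fun ω => g (Z i ω)) 2 μ :=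
  memLp_comp_of_finite (hZ.measurable i) g

theorem memLp_comp_succ (hZ : IsMarkovChain μ P W Z) (i : ℕ) (u : S → S → ℝ) :
    MemLp (fun ω => u (Z (i + 1) ω) (Z i ω)) 2 μ :=
  memLp_comp_of_finite ((hZ.measurable (i + 1)).prodMk (hZ.measurable i)) fun p => u p.1 p.2

theorem memLp_sum (hZ : IsMarkovChain μ P W Z) (m : ℕ) (u : S → S → ℝ) :
    MemLp (fun ω => ∑ i ∈ Finset.range m, u (Z (i + 1) ω) (Z i ω)) 2 μ :=
  memLp_finsetSum _ fun i _ => hZ.memLp_comp_succ i u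

end Finite

variable [Fintype S] [IsFiniteMeasure μ]

theorem integral_comp_firstVars (hZ : IsMarkovChain μ P W Z) (n : ℕ)
    (ψ : (Fin (n + 1) → S) → ℝ) :
    ∫ ω, ψ (firstVars Z (n + 1) ω) ∂μ = ∑ z, pathWeight P W z * ψ z := by
  have path_measurable := measurable_firstVars hZ.measurable (n + 1)
  rw [← integral_map (f := ψ) path_measurable.aemeasurable .of_discrete,
    integral_fintype .of_finite]
  refine Finset.sum_congr rfl fun z _ => ?_
  rw [map_measureReal_apply path_measurable (measurableSet_singleton z),
    hZ.measureReal_firstVars_preimage, smul_eq_mul]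

theorem integral_mul_step (hZ : IsMarkovChain μ P W Z) (n : ℕ) (ψ : (Fin (n + 1) → S) → ℝ)
    (u : S → S → ℝ) :
    ∫ ω, ψ (firstVars Z (n + 1) ω) * u (Z (n + 1) ω) (Z n ω) ∂μ =
      ∫ ω, ψ (firstVars Z (n + 1) ω) * stepMean W u (Z n ω) ∂μ := by
  calc _ = ∑ z : Fin (n + 2) → S, pathWeight P W z *
        (ψ (Fin.init z) * u (z (Fin.last (n + 1))) (z (Fin.last n).castSucc)) :=
        hZ.integral_comp_firstVars (n + 1) _
    _ = ∑ z : Fin (n + 1) → S, pathWeight P W z * (ψ z * stepMean W u (z (Fin.last n))) := by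
        simp only [sum_snoc (n := n + 1), pathWeight_succ, Fin.init_snoc, Fin.snoc_last,
          Fin.snoc_castSucc, stepMean, Finset.mul_sum]
        exact Finset.sum_congr rfl fun z _ => Finset.sum_congr rfl fun a _ => by ring
    _ = _ := (hZ.integral_comp_firstVars n _).symm

theorem integral_comp_succ (hZ : IsMarkovChain μ P W Z) (n : ℕ) (u : S → S → ℝ) :
    ∫ ω, u (Z (n + 1) ω) (Z n ω) ∂μ = ∫ ω, stepMean W u (Z n ω) ∂μ := by
  simpa only [one_mul] using hZ.integral_mul_step n (fun _ => 1) u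

variable {D : S → S → ℝ}

theorem integral_sum_eq_zero (hZ : IsMarkovChain μ P W Z) (hD : ∀ b, stepMean W D b = 0) (m : ℕ) :
    ∫ ω, ∑ i ∈ Finset.range m, D (Z (i + 1) ω) (Z i ω) ∂μ = 0 := by
  rw [integral_finsetSum _ fun i _ => (hZ.memLp_comp_succ i D).integrable one_le_two]
  refine Finset.sum_eq_zero fun i _ => ?_
  simp only [hZ.integral_comp_succ i D, hD, integral_zero]

theorem integral_sum_mul_eq_zero (hZ : IsMarkovChain μ P W Z) (hD : ∀ b, stepMean W D b = 0)
    (m : ℕ) : ∫ ω, (∑ i ∈ Finset.range m, D (Z (i + 1) ω) (Z i ω)) *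
      D (Z (m + 1) ω) (Z m ω) ∂μ = 0 := by
  have markov := hZ.integral_mul_step m (fun z => ∑ i : Fin m, D (z i.succ) (z i.castSucc)) D
  simp only [hD, mul_zero, integral_zero] at markov
  simp only [Finset.sum_range]
  exact markov

theorem integral_sum_sq (hZ : IsMarkovChain μ P W Z) (hD : ∀ b, stepMean W D b = 0) (m : ℕ) :
    ∫ ω, (∑ i ∈ Finset.range m, D (Z (i + 1) ω) (Z i ω)) ^ 2 ∂μ =
      ∑ i ∈ Finset.range m, ∫ ω, stepMean W (fun a b => D a b ^ 2) (Z i ω) ∂μ := by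
  induction m with
  | zero => simp
  | succ m ih =>
    have sum_memLp := hZ.memLp_sum m D
    have step_memLp := hZ.memLp_comp_succ m D
    have cross_integrable : Integrable (fun ω => 2 * ((∑ i ∈ Finset.range m,
        D (Z (i + 1) ω) (Z i ω)) * D (Z (m + 1) ω) (Z m ω))) μ :=
      (sum_memLp.integrable_mul step_memLp).const_mul 2
    have partial_integrable : Integrable (fun ω => (∑ i ∈ Finset.range m,
        D (Z (i + 1) ω) (Z i ω)) ^ 2 + 2 * ((∑ i ∈ Finset.range m,
        D (Z (i + 1) ω) (Z i ω)) * D (Z (m + 1) ω) (Z m ω))) μ :=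
      sum_memLp.integrable_sq.add cross_integrable
    simp only [Finset.sum_range_succ, add_sq, mul_assoc (2 : ℝ)]
    rw [integral_add partial_integrable step_memLp.integrable_sq,
      integral_add sum_memLp.integrable_sq cross_integrable, ih, integral_const_mul,
      hZ.integral_sum_mul_eq_zero hD, hZ.integral_comp_succ m fun a b => D a b ^ 2,
      mul_zero, add_zero]

theorem sum_integral_poisson [IsProbabilityMeasure μ] (hZ : IsMarkovChain μ P W Z) (v : ℝ)
    (k : S → ℝ) (m : ℕ) :
    ∑ i ∈ Finset.range m, ∫ ω, (v + k (Z i ω) - (k ᵥ* W) (Z i ω)) ∂μ =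
      m * v + (∫ ω, k (Z 0 ω) ∂μ - ∫ ω, k (Z m ω) ∂μ) := by
  have integrable_comp : ∀ i (g : S → ℝ), Integrable (fun ω => g (Z i ω)) μ := fun i g =>
    (hZ.memLp_comp i g).integrable one_le_two
  have step : ∀ i, ∫ ω, (v + k (Z i ω) - (k ᵥ* W) (Z i ω)) ∂μ =
      v + (∫ ω, k (Z i ω) ∂μ - ∫ ω, k (Z (i + 1) ω) ∂μ) := by
    intro i
    rw [integral_sub (integrable_comp i fun s => v + k s) (integrable_comp i _),
      integral_add (integrable_const v) (integrable_comp i k), integral_const, probReal_univ,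
      one_smul, hZ.integral_comp_succ i fun a _ => k a, add_sub_assoc]
    simp only [stepMean_fst]
  simp only [step, Finset.sum_add_distrib, Finset.sum_range_sub', Finset.sum_const,
    Finset.card_range, nsmul_eq_mul]

theorem variance_sum_eq [IsProbabilityMeasure μ] (hZ : IsMarkovChain μ P W Z)
    (hD : ∀ b, stepMean W D b = 0) {v : ℝ} {k : S → ℝ}
    (hv : ∀ b, stepMean W (fun a b => D a b ^ 2) b = v + k b - (k ᵥ* W) b) (m : ℕ) :
    Var[fun ω => ∑ i ∈ Finset.range m, D (Z (i + 1) ω) (Z i ω); μ] =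
      m * v + (∫ ω, k (Z 0 ω) ∂μ - ∫ ω, k (Z m ω) ∂μ) := by
  rw [variance_of_integral_eq_zero (hZ.memLp_sum m D).aestronglyMeasurable.aemeasurable
    (hZ.integral_sum_eq_zero hD m), hZ.integral_sum_sq hD, ← hZ.sum_integral_poisson]
  simp only [hv]

theorem tendsto_variance_sum_div [IsProbabilityMeasure μ] (hZ : IsMarkovChain μ P W Z)
    (hD : ∀ b, stepMean W D b = 0) {v : ℝ} {k : S → ℝ}
    (hv : ∀ b, stepMean W (fun a b => D a b ^ 2) b = v + k b - (k ᵥ* W) b) :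
    Tendsto (fun m : ℕ => Var[fun ω => ∑ i ∈ Finset.range m, D (Z (i + 1) ω) (Z i ω); μ] / m)
      atTop (𝓝 v) := by
  obtain ⟨C, hC⟩ := Finite.exists_le fun s => |k s|
  have integral_mem : ∀ i, |∫ ω, k (Z i ω) ∂μ| ≤ C := fun i => by
    simpa using norm_integral_le_of_norm_le_const (μ := μ) (f := fun ω => k (Z i ω))
      (ae_of_all _ fun ω => hC (Z i ω))
  have boundary_lim : Tendsto (fun m : ℕ => (∫ ω, k (Z 0 ω) ∂μ - ∫ ω, k (Z m ω) ∂μ) / m)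
      atTop (𝓝 0) := by
    refine tendsto_bdd_div_atTop_nhds_zero (b := -(C + C)) (B := C + C)
      (Eventually.of_forall fun m => ?_) (Eventually.of_forall fun m => ?_)
      tendsto_natCast_atTop_atTop
    · linarith [(abs_le.1 (integral_mem 0)).1, (abs_le.1 (integral_mem m)).2]
    · linarith [(abs_le.1 (integral_mem 0)).2, (abs_le.1 (integral_mem m)).1]
  have limit := boundary_lim.const_add v
  rw [add_zero] at limit
  refine limit.congr' ?_
  filter_upwards [eventually_ne_atTop 0] with m hm
  rw [hZ.variance_sum_eq hD hv, add_div, mul_div_cancel_left₀ v (Nat.cast_ne_zero.2 hm)]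

end IsMarkovChain

end Chain

section NonHidden

variable {X Y : Type*} {P : X × Y → ℝ} {W : Matrix (X × Y) (X × Y) ℝ} {WY : Matrix Y Y ℝ}

theorem IsNonHidden.sum_pathWeight [Fintype X] (hWY : IsNonHidden W WY) (P : X × Y → ℝ)
    {n : ℕ} (y : Fin (n + 1) → Y) :
    ∑ x : Fin (n + 1) → X, pathWeight P W (fun i => (x i, y i)) =
      pathWeight (fun y => ∑ x, P (x, y)) WY y := by
  induction n with
  | zero =>
    simp only [pathWeight, Finset.univ_eq_empty, Finset.prod_empty, mul_one]
    exact (Equiv.funUnique (Fin 1) X).sum_comp fun x => P (x, y 0)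
  | succ n ih =>
    rw [pathWeight_succ _ WY, ← ih, sum_snoc, Finset.sum_mul]
    refine Finset.sum_congr rfl fun x _ => ?_
    rw [← hWY (x (Fin.last n)), Finset.mul_sum]
    refine Finset.sum_congr rfl fun a _ => ?_
    simp only [pathWeight_succ _ W, Fin.init_def, Fin.snoc_castSucc, Fin.snoc_last]

variable {Ω : Type*} [MeasurableSpace Ω] {μ : Measure Ω} {U : ℕ → Ω → X} {V : ℕ → Ω → Y}
  [MeasurableSpace X] [MeasurableSpace Y]

theorem IsMarkovChain.measureReal_firstVars_inter
    (hZ : IsMarkovChain μ P W fun i ω => (U i ω, V i ω)) {n : ℕ}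
    (x : Fin (n + 1) → X) (y : Fin (n + 1) → Y) :
    μ.real (firstVars V (n + 1) ⁻¹' {y} ∩ firstVars U (n + 1) ⁻¹' {x}) =
      pathWeight P W fun i => (x i, y i) := by
  rw [← hZ.measureReal_firstVars_preimage]
  congr 1
  ext ω
  simp [firstVars, funext_iff, forall_and, and_comm]

variable [Fintype X]

namespace IsMarkovChain

variable [MeasurableSingletonClass X] [MeasurableSingletonClass Y] [IsFiniteMeasure μ]

theorem isMarkovChain_snd (hZ : IsMarkovChain μ P W fun i ω => (U i ω, V i ω))
    (hWY : IsNonHidden W WY) : IsMarkovChain μ (fun y => ∑ x, P (x, y)) WY V where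
  measurable i := (hZ.measurable i).snd
  path_prob n y := by
    classical
    have measurable_fst := measurable_firstVars (fun i => (hZ.measurable i).fst) (n + 1)
    have measurable_snd := measurable_firstVars (fun i => (hZ.measurable i).snd) (n + 1)
    rw [setOf_forall_eq_preimage_firstVars]
    calc μ.real (firstVars V (n + 1) ⁻¹' {y})
        = μ.real (⋃ x, firstVars V (n + 1) ⁻¹' {y} ∩ firstVars U (n + 1) ⁻¹' {x}) := by
          rw [← Set.inter_iUnion, ← Set.preimage_iUnion, Set.iUnion_of_singleton,
            Set.preimage_univ, Set.inter_univ]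
      _ = ∑ x, μ.real (firstVars V (n + 1) ⁻¹' {y} ∩ firstVars U (n + 1) ⁻¹' {x}) :=
          measureReal_iUnion_fintype
            (fun x x' hx => Set.disjoint_left.2 fun ω h h' => hx (h.2.symm.trans h'.2))
            fun x => (measurable_snd (measurableSet_singleton y)).inter
              (measurable_fst (measurableSet_singleton x))
      _ = pathWeight (fun y => ∑ x, P (x, y)) WY y := by
          simp only [hZ.measureReal_firstVars_inter, hWY.sum_pathWeight]

theorem condProb_firstVars (hZ : IsMarkovChain μ P W fun i ω => (U i ω, V i ω))
    (hWY : IsNonHidden W WY) {n : ℕ} (x : Fin (n + 1) → X) (y : Fin (n + 1) → Y) :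
    condProb μ (firstVars U (n + 1)) (firstVars V (n + 1)) x y =
      pathWeight P W (fun i => (x i, y i)) / pathWeight (fun y => ∑ x, P (x, y)) WY y := by
  have hV := hZ.isMarkovChain_snd hWY
  have measurable_snd := measurable_firstVars hV.measurable (n + 1)
  rw [condProb, measureReal_def, cond_apply (measurable_snd (measurableSet_singleton y)),
    ENNReal.toReal_mul, ENNReal.toReal_inv, ← measureReal_def, ← measureReal_def,
    hZ.measureReal_firstVars_inter, hV.measureReal_firstVars_preimage, inv_mul_eq_div]

theorem ae_log_condProb [Finite Y] (hZ : IsMarkovChain μ P W fun i ω => (U i ω, V i ω))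
    (hWY : IsNonHidden W WY) (n : ℕ) :
    ∀ᵐ ω ∂μ, Real.log (1 / condProb μ (firstVars U (n + 1)) (firstVars V (n + 1))
        (firstVars U (n + 1) ω) (firstVars V (n + 1) ω)) =
      Real.log (∑ x, P (x, V 0 ω)) - Real.log (P (U 0 ω, V 0 ω)) -
        ∑ i ∈ Finset.range n, logRatio W WY (U (i + 1) ω, V (i + 1) ω) (U i ω, V i ω) := by
  filter_upwards [hZ.ae_pathWeight_ne_zero n, (hZ.isMarkovChain_snd hWY).ae_pathWeight_ne_zero n]
    with ω joint_ne marginal_ne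
  have joint_ne : pathWeight P W
      (fun i => (firstVars U (n + 1) ω i, firstVars V (n + 1) ω i)) ≠ 0 := joint_ne
  rw [hZ.condProb_firstVars hWY, one_div_div, Real.log_div marginal_ne joint_ne,
    log_pathWeight marginal_ne, log_pathWeight joint_ne, Finset.sum_range]
  simp only [logRatio, Finset.sum_sub_distrib, firstVars, Fin.val_zero, Fin.val_succ,
    Fin.val_castSucc]
  ring

end IsMarkovChain

end NonHidden

section AsymptoticVariance

variable {Ω : Type*} [MeasurableSpace Ω] {μ : Measure Ω} [IsProbabilityMeasure μ]

theorem sum_martingaleDiff {S : Type*} (u : S → S → ℝ) (α : ℝ) (h : S → ℝ) (z : ℕ → S) (m : ℕ) :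
    ∑ i ∈ Finset.range m, martingaleDiff u α h (z (i + 1)) (z i) =
      ∑ i ∈ Finset.range m, u (z (i + 1)) (z i) - m * α + (h (z m) - h (z 0)) := by
  rw [← Finset.sum_range_sub fun i => h (z i)]
  simp only [martingaleDiff, add_sub_assoc, Finset.sum_add_distrib, Finset.sum_sub_distrib,
    Finset.sum_const, Finset.card_range, nsmul_eq_mul]

theorem IsMartingaleDecomposition.tendsto_variance {S : Type*} [Fintype S] [MeasurableSpace S]
    [MeasurableSingletonClass S] {W : Matrix S S ℝ} {u : S → S → ℝ} {α v : ℝ} {h k : S → ℝ}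
    (E : IsMartingaleDecomposition W u α v h k) {P : S → ℝ} {Z : ℕ → Ω → S}
    (hZ : IsMarkovChain μ P W Z) (r : S → ℝ) :
    Tendsto (fun m : ℕ =>
        Var[fun ω => r (Z 0 ω) - ∑ i ∈ Finset.range m, u (Z (i + 1) ω) (Z i ω); μ] / m)
      atTop (𝓝 v) := by
  let boundary : S × S → ℝ := fun s => r s.1 - h s.1 + h s.2
  have ends_measurable : ∀ m, Measurable fun ω => (Z 0 ω, Z m ω) := fun m =>
    (hZ.measurable 0).prodMk (hZ.measurable m)
  have boundary_memLp : ∀ m, MemLp (fun ω => boundary (Z 0 ω, Z m ω)) 2 μ := fun m =>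
    memLp_comp_of_finite (ends_measurable m) boundary
  obtain ⟨K, hK⟩ := exists_forall_variance_comp_le (μ := μ) boundary
  have boundary_lim : Tendsto (fun m : ℕ => Var[fun ω => boundary (Z 0 ω, Z m ω); μ] / m)
      atTop (𝓝 0) :=
    tendsto_bdd_div_atTop_nhds_zero (Eventually.of_forall fun _ => variance_nonneg _ _)
      (Eventually.of_forall fun m => hK _ (ends_measurable m)) tendsto_natCast_atTop_atTop
  refine (tendsto_variance_sub_div boundary_memLp
    (fun m => hZ.memLp_sum m (martingaleDiff u α h)) boundary_lim
    (hZ.tendsto_variance_sum_div E.stepMean_eq_zero E.stepMean_sq)).congr fun m => ?_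
  congr 1
  refine (variance_const_add ((boundary_memLp m).sub
    (hZ.memLp_sum m (martingaleDiff u α h))).aestronglyMeasurable (-(m * α))).symm.trans ?_
  congr 1
  funext ω
  simp only [boundary, Pi.sub_apply, sum_martingaleDiff u α h fun i => Z i ω]
  ring

theorem IsMartingaleDecomposition.tendsto_condVar {X Y : Type*} [Fintype X] [Fintype Y]
    [MeasurableSpace X] [MeasurableSingletonClass X] [MeasurableSpace Y]
    [MeasurableSingletonClass Y] {W : Matrix (X × Y) (X × Y) ℝ} {WY : Matrix Y Y ℝ} {α v : ℝ}
    {h k : X × Y → ℝ} (E : IsMartingaleDecomposition W (logRatio W WY) α v h k)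
    (hWY : IsNonHidden W WY) {P : X × Y → ℝ} {U : ℕ → Ω → X} {V : ℕ → Ω → Y}
    (hZ : IsMarkovChain μ P W fun i ω => (U i ω, V i ω)) :
    Tendsto (fun n : ℕ => 1 / (n : ℝ) * condVar μ (firstVars U n) (firstVars V n))
      atTop (𝓝 v) := by
  have variance_lim := (tendsto_natCast_div_add_atTop (1 : ℝ)).mul (E.tendsto_variance hZ
    fun s => Real.log (∑ x, P (x, s.2)) - Real.log (P s))
  rw [one_mul] at variance_lim
  refine (tendsto_add_atTop_iff_nat 1).1 (variance_lim.congr' ?_)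
  filter_upwards [eventually_ne_atTop 0] with m hm
  have hm : (m : ℝ) ≠ 0 := Nat.cast_ne_zero.2 hm
  rw [condVar, variance_congr (hZ.ae_log_condProb hWY m), Nat.cast_add_one]
  field_simp

end AsymptoticVariance

end MarkovVariance

theorem mainTheorem2_general
    {𝒳 𝒴 : Type*} [Fintype 𝒳] [DecidableEq 𝒳] [Fintype 𝒴] [DecidableEq 𝒴]
    [MeasurableSpace 𝒳] [MeasurableSingletonClass 𝒳]
    [MeasurableSpace 𝒴] [MeasurableSingletonClass 𝒴]
    (W : Matrix (𝒳 × 𝒴) (𝒳 × 𝒴) ℝ) (hW : W ∈ Matrix.colStochastic ℝ (𝒳 × 𝒴))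
    (hU : MarkovVariance.IsUnichain W)
    (WY : Matrix 𝒴 𝒴 ℝ) (hWY : MarkovVariance.IsNonHidden W WY)
    (P : 𝒳 × 𝒴 → ℝ)
    {Ω : Type*} [MeasurableSpace Ω] (μ : MeasureTheory.Measure Ω)
    [MeasureTheory.IsProbabilityMeasure μ]
    (X : ℕ → Ω → 𝒳) (Y : ℕ → Ω → 𝒴)
    (hXY : MarkovVariance.IsMarkovChain μ P W (fun i ω => (X i ω, Y i ω))) :
    Filter.Tendsto (MarkovVariance.lowerRenyi W WY) (nhdsWithin (0 : ℝ) {0}ᶜ)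
        (nhds (MarkovVariance.condEntropyW W WY)) ∧
      Filter.Tendsto (MarkovVariance.varQuotient W WY) (nhdsWithin (0 : ℝ) {0}ᶜ)
        (nhds (MarkovVariance.varianceW W WY)) ∧
      Filter.Tendsto
        (fun n : ℕ => (1 / (n : ℝ)) *
          MarkovVariance.condVar μ (MarkovVariance.firstVars X n) (MarkovVariance.firstVars Y n))
        Filter.atTop (nhds (MarkovVariance.varianceW W WY)) := by
  have : Nonempty Ω := μ.nonempty_of_neZero
  have : Nonempty (𝒳 × 𝒴) := Nonempty.map (fun ω => (X 0 ω, Y 0 ω)) this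
  obtain ⟨α, v, h, k, E⟩ :=
    hU.exists_isMartingaleDecomposition hW (MarkovVariance.logRatio W WY)
  rw [E.condEntropyW_eq hW hWY, E.varianceW_eq hW hWY]
  exact ⟨E.tendsto_lowerRenyi hW hWY, E.tendsto_varQuotient hW hWY, E.tendsto_condVar hWY hXY⟩

/-- The first two conjuncts say that the limits defining `H^W(X|Y)` and `V^W(X|Y)` exist. -/
theorem mainTheorem2
    {𝒳 𝒴 : Type*} [Fintype 𝒳] [DecidableEq 𝒳] [Fintype 𝒴] [DecidableEq 𝒴]
    [MeasurableSpace 𝒳] [MeasurableSingletonClass 𝒳]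
    [MeasurableSpace 𝒴] [MeasurableSingletonClass 𝒴]
    (W : Matrix (𝒳 × 𝒴) (𝒳 × 𝒴) ℝ) (hW : W ∈ Matrix.colStochastic ℝ (𝒳 × 𝒴))
    (hirr : W.IsIrreducible)
    (WY : Matrix 𝒴 𝒴 ℝ) (hWY : MarkovVariance.IsNonHidden W WY)
    (P : 𝒳 × 𝒴 → ℝ) (hP : P ∈ stdSimplex ℝ (𝒳 × 𝒴))
    {Ω : Type*} [MeasurableSpace Ω] (μ : MeasureTheory.Measure Ω)
    [MeasureTheory.IsProbabilityMeasure μ]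
    (X : ℕ → Ω → 𝒳) (Y : ℕ → Ω → 𝒴)
    (hXY : MarkovVariance.IsMarkovChain μ P W (fun i ω => (X i ω, Y i ω))) :
    Filter.Tendsto (MarkovVariance.lowerRenyi W WY) (nhdsWithin (0 : ℝ) {0}ᶜ)
        (nhds (MarkovVariance.condEntropyW W WY)) ∧
      Filter.Tendsto (MarkovVariance.varQuotient W WY) (nhdsWithin (0 : ℝ) {0}ᶜ)
        (nhds (MarkovVariance.varianceW W WY)) ∧
      Filter.Tendsto
        (fun n : ℕ => (1 / (n : ℝ)) *
          MarkovVariance.condVar μ (MarkovVariance.firstVars X n) (MarkovVariance.firstVars Y n))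
        Filter.atTop (nhds (MarkovVariance.varianceW W WY)) :=
  mainTheorem2_general W hW (MarkovVariance.isUnichain_of_isIrreducible hW hirr) WY hWY P μ X Y hXY
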